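/- **Proposition 7.4 (Horizontal lift characterization of generalized principal connections).** All manifolds are real, smooth, Hausdorff and finite-dimensional, and all fiber bundles are smooth and locally trivial. Let $(\mathcal G, M, \pi_{\mathcal G,M}, G)$ be a Lie group fiber bundle: $G$ is a Lie group, every fiber $\mathcal G_x$ $(x\in M)$ is a Lie group with unit $e_x$, and around every point of $M$ there is a local trivialization $\pi_{\mathcal G,M}^{-1}(U)\to U\times G$ restricting to Lie group isomorphisms $\mathcal G_x\to\{x\}\times G\equiv G$. Let $(P, M, \pi_{P,M}, F)$ be a fiber bundle and put $P\times_M\mathcal G=\{(p,\gamma)\in P\times\mathcal G : \pi_{P,M}(p)=\pi_{\mathcal G,M}(\gamma)\}$. Let $\Phi\colon P\times_M\mathcal G\to P$ be a smooth right fibered action, i.e. $\pi_{P,M}(\Phi(p,\gamma))=\pi_{P,M}(p)$, $\Phi(p,e_x)=p$ for $p\in P_x=\pi_{P,M}^{-1}(x)$, and $\Phi(p,\gamma_1\cdot\gamma_2)=\Phi(\Phi(p,\gamma_1),\gamma_2)$. Suppose that $\Phi$ is free ($\Phi(p,\gamma)=p$ with $p\in P_x$ implies $\gamma=e_x$) and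 proper (the map $P\times_M\mathcal G\to P\times_M P$, $(p,\gamma)\mapsto(p,\Phi(p,\gamma))$, is proper). Let $\mathcal S=P/\mathcal G$ be the orbit space, with projections $\pi_{P,\mathcal S}\colon P\to\mathcal S$ and $\pi_{\mathcal S,M}\colon\mathcal S\to M$, $\pi_{\mathcal S,M}\circ\pi_{P,\mathcal S}=\pi_{P,M}$, equipped with its smooth structure for which $(P,\mathcal S,\pi_{P,\mathcal S},G)$ is a fiber bundle (the generalized principal bundle). A connection on a fiber bundle $\pi\colon Q\to B$ is a smooth vector bundle morphism $\nu\colon TQ\to VQ=\ker T\pi$ over $\mathrm{id}_Q$ with $\nu|_{VQ}=\mathrm{id}$ (the vertical projection). Equivalently it is given by its horizontal lifts $T_{\pi(q)}B\to T_qQ$, the inverses of the isomorphisms $T_q\pi|_{\ker\nu_q}\colon \ker\nu_q\to T_{\pi(q)}B$. Fix a connection on $(\mathcal G,M,\pi_{\mathcal G,M},G)$ with vertical projection $\nu$ and horizontal lifts $\eta_\gamma$, and let a connection on $(P,\mathcal S,\pi_{P,\mathcal S},G)$ with vertical projection $\omega$ and horizontal lifts $\tau_p\colon T_{\pi_{P,\mathcal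 S}(p)}\mathcal S\to T_pP$ be given. The latter is called a generalized principal connection associated to the former if, for all $(p,\gamma)\in P\times_M\mathcal G$ and all $(z,v)\in T_pP\times T_\gamma\mathcal G$ with $T_p\pi_{P,M}(z)=T_\gamma\pi_{\mathcal G,M}(v)$, $$\omega_{\Phi(p,\gamma)}\big(T_{(p,\gamma)}\Phi(z,v)\big)=T_p\Phi_\gamma\big(\omega_p(z)\big)+\big(T_\gamma L_{\gamma^{-1}}(\nu_\gamma(v))\big)^*_{\Phi(p,\gamma)}.$$ Here, with $x=\pi_{P,M}(p)=\pi_{\mathcal G,M}(\gamma)$, we write $\Phi_\gamma\colon P_x\to P_x$, $q\mapsto\Phi(q,\gamma)$; $L_{\gamma^{-1}}\colon\mathcal G_x\to\mathcal G_x$, $\delta\mapsto\gamma^{-1}\cdot\delta$; $\Phi_q\colon\mathcal G_x\to P_x$, $\delta\mapsto\Phi(q,\delta)$ for $q\in P_x$; and $\xi^*_q=T_{e_x}\Phi_q(\xi)$ for $\xi\in T_{e_x}\mathcal G_x$. Then the connection on $(P,\mathcal S,\pi_{P,\mathcal S},G)$ is a generalized principal connection associated to the given connection on $\mathcal G$ if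 and only if $$\tau_{\Phi(p,\gamma)}=T_{(p,\gamma)}\Phi\Big(\tau_p(\cdot),\,\eta_\gamma\big(T_{\pi_{P,\mathcal S}(p)}\pi_{\mathcal S,M}(\cdot)\big)\Big)\qquad\text{for all }(p,\gamma)\in P\times_M\mathcal G .$$ -/

import Mathlib

open scoped Manifold ContDiff Topology

noncomputable section

namespace GenPrincipal

section FiberBundles

variable (EQ EB EF : Type*)
  [NormedAddCommGroup EQ] [NormedSpace ℝ EQ]
  [NormedAddCommGroup EB] [NormedSpace ℝ EB]
  [NormedAddCommGroup EF] [NormedSpace ℝ EF]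
  {Q B : Type*} (F : Type*)
  [TopologicalSpace Q] [ChartedSpace EQ Q]
  [TopologicalSpace B] [ChartedSpace EB B]
  [TopologicalSpace F] [ChartedSpace EF F]

/-- A local trivialization `π ⁻¹(U) → U × F` (over `U = e.baseSet`) that is a diffeomorphism. -/
structure IsSmoothTrivialization {π : Q → B} (e : Bundle.Trivialization F π) : Prop where
  contMDiffOn_toFun :
    ContMDiffOn 𝓘(ℝ, EQ) (𝓘(ℝ, EB).prod 𝓘(ℝ, EF)) ∞ e e.source
  contMDiffOn_symm :
    ContMDiffOn (𝓘(ℝ, EB).prod 𝓘(ℝ, EF)) 𝓘(ℝ, EQ) ∞ e.toOpenPartialHomeomorph.symm e.target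

/-- `(Q, B, π, F)` is a smooth, locally trivial fiber bundle with total space `Q`, base `B`,
projection `π` and standard fiber `F`. -/
structure IsSmoothFiberBundle (π : Q → B) : Prop where
  contMDiff_proj : ContMDiff 𝓘(ℝ, EQ) 𝓘(ℝ, EB) ∞ π
  exists_trivialization : ∀ b : B, ∃ e : Bundle.Trivialization F π,
    b ∈ e.baseSet ∧ IsSmoothTrivialization EQ EB EF F e

variable {EQ EB EF F}

/-- The projection of a smooth fiber bundle is a submersion. -/
theorem IsSmoothFiberBundle.surjective_mfderiv {π : Q → B}
    (h : IsSmoothFiberBundle EQ EB EF F π) (q : Q) :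
    Function.Surjective (mfderiv 𝓘(ℝ, EQ) 𝓘(ℝ, EB) π q) := by
  obtain ⟨e, hb, he⟩ := h.exists_trivialization (π q)
  have hq : q ∈ e.source := e.mem_source.2 hb
  let s : B → Q := fun b => e.toOpenPartialHomeomorph.symm (b, (e q).2)
  have hsq : s (π q) = q := by
    have h1 : ((π q, (e q).2) : B × F) = e q := Prod.ext (e.coe_fst hq).symm rfl
    change e.toOpenPartialHomeomorph.symm (π q, (e q).2) = q
    rw [h1]
    exact e.toOpenPartialHomeomorph.left_inv hq
  have hs : MDifferentiableAt 𝓘(ℝ, EB) 𝓘(ℝ, EQ) s (π q) := by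
    have h1 : ContMDiffOn 𝓘(ℝ, EB) 𝓘(ℝ, EQ) ∞ s e.baseSet :=
      he.contMDiffOn_symm.comp (contMDiffOn_id.prodMk contMDiffOn_const)
        (fun b hb' => e.mem_target.2 hb')
    exact (h1.contMDiffAt (e.open_baseSet.mem_nhds hb)).mdifferentiableAt (by simp)
  have hπ : MDifferentiableAt 𝓘(ℝ, EQ) 𝓘(ℝ, EB) π (s (π q)) :=
    (h.contMDiff_proj _).mdifferentiableAt (by simp)
  have hcomp : π ∘ s =ᶠ[𝓝 (π q)] id := by
    filter_upwards [e.open_baseSet.mem_nhds hb] with b hb'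
    exact e.proj_symm_apply' hb'
  have key := mfderiv_comp (π q) hπ hs
  rw [hcomp.mfderiv_eq, mfderiv_id] at key
  intro a
  have h2 := congrArg (fun L => L a) key
  have h3 : ∀ q' : Q, q' = q → ∀ w : EQ,
      (mfderiv 𝓘(ℝ, EQ) 𝓘(ℝ, EB) π q' w : EB) = mfderiv 𝓘(ℝ, EQ) 𝓘(ℝ, EB) π q w := by
    rintro _ rfl w
    rfl
  exact ⟨mfderiv 𝓘(ℝ, EB) 𝓘(ℝ, EQ) s (π q) a, (h3 _ hsq _).symm.trans h2.symm⟩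

/-- A connection on the fiber bundle `(Q, B, π, F)`: a smooth vector bundle morphism
`ν : T Q → V Q = ker (T π)` over the identity of `Q` which restricts to the identity on `V Q`. -/
structure Connection [IsManifold 𝓘(ℝ, EQ) ∞ Q] {π : Q → B}
    (_h : IsSmoothFiberBundle EQ EB EF F π) where
  /-- the vertical projection `ν_q : T_q Q → V_q Q` -/
  vert : ∀ q : Q, TangentSpace 𝓘(ℝ, EQ) q →L[ℝ] TangentSpace 𝓘(ℝ, EQ) q
  mfderiv_vert : ∀ (q : Q) (z : TangentSpace 𝓘(ℝ, EQ) q),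
    mfderiv 𝓘(ℝ, EQ) 𝓘(ℝ, EB) π q (vert q z) = 0
  vert_eq_self : ∀ (q : Q) (z : TangentSpace 𝓘(ℝ, EQ) q),
    mfderiv 𝓘(ℝ, EQ) 𝓘(ℝ, EB) π q z = 0 → vert q z = z
  contMDiff_vert : ContMDiff 𝓘(ℝ, EQ).tangent 𝓘(ℝ, EQ).tangent ∞
    (fun z : TangentBundle 𝓘(ℝ, EQ) Q =>
      (⟨z.proj, vert z.proj z.snd⟩ : TangentBundle 𝓘(ℝ, EQ) Q))

namespace Connection

variable [IsManifold 𝓘(ℝ, EQ) ∞ Q] {π : Q → B} {h : IsSmoothFiberBundle EQ EB EF F π}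
  (ν : Connection h)

/-- The horizontal subspace `H_q Q = ker ν_q`. -/
def hor (q : Q) : Submodule ℝ (TangentSpace 𝓘(ℝ, EQ) q) :=
  LinearMap.ker (ν.vert q).toLinearMap

/-- The restriction of `T_q π` to the horizontal subspace. -/
def projHor (q : Q) : ν.hor q →ₗ[ℝ] TangentSpace 𝓘(ℝ, EB) (π q) :=
  (mfderiv 𝓘(ℝ, EQ) 𝓘(ℝ, EB) π q).toLinearMap.domRestrict (ν.hor q)

theorem bijective_projHor (q : Q) : Function.Bijective (ν.projHor q) := by
  constructor
  · rw [injective_iff_map_eq_zero]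
    rintro ⟨z, hz⟩ hz'
    have h1 : ν.vert q z = z := ν.vert_eq_self q z hz'
    have h2 : ν.vert q z = 0 := hz
    exact Subtype.ext (h1.symm.trans h2)
  · intro a
    obtain ⟨z, hz⟩ := h.surjective_mfderiv q a
    have h1 : ν.vert q (ν.vert q z) = ν.vert q z := ν.vert_eq_self q _ (ν.mfderiv_vert q z)
    refine ⟨⟨z - ν.vert q z, ?_⟩, ?_⟩
    · change ν.vert q (z - ν.vert q z) = 0
      rw [map_sub, h1, sub_self]
    · change mfderiv 𝓘(ℝ, EQ) 𝓘(ℝ, EB) π q (z - ν.vert q z) = a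
      rw [map_sub, ν.mfderiv_vert, sub_zero, hz]

/-- The horizontal lift `T_{π(q)} B → T_q Q` at `q`: the inverse of the isomorphism
`T_q π : H_q Q → T_{π(q)} B`. -/
def horizontalLift (q : Q) : TangentSpace 𝓘(ℝ, EB) (π q) →ₗ[ℝ] TangentSpace 𝓘(ℝ, EQ) q :=
  (ν.hor q).subtype ∘ₗ (LinearEquiv.ofBijective (ν.projHor q) (ν.bijective_projHor q)).symm

end Connection

end FiberBundles

section LieGroupBundles

variable (E𝒢 EM EG : Type*)
  [NormedAddCommGroup E𝒢] [NormedSpace ℝ E𝒢]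
  [NormedAddCommGroup EM] [NormedSpace ℝ EM]
  [NormedAddCommGroup EG] [NormedSpace ℝ EG]
  {𝒢 M : Type*} (G : Type*)
  [TopologicalSpace 𝒢] [ChartedSpace E𝒢 𝒢]
  [TopologicalSpace M] [ChartedSpace EM M]
  [TopologicalSpace G] [ChartedSpace EG G] [Group G]

/-- A Lie group fiber bundle `(𝒢, M, π, G)` with typical fiber the Lie group `G`: a smooth fiber
bundle with a group structure on every fiber and, around every point of `M`, a smooth local
trivialization which is a group isomorphism on every fiber (through which every fiber is a Lie
group isomorphic to `G`). The values of `mul` on pairs from different fibers are irrelevant. -/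
structure LieGroupFiberBundle (π : 𝒢 → M) where
  isFiberBundle : IsSmoothFiberBundle E𝒢 EM EG G π
  mul : 𝒢 → 𝒢 → 𝒢
  one : M → 𝒢
  inv : 𝒢 → 𝒢
  proj_mul : ∀ γ δ, π γ = π δ → π (mul γ δ) = π γ
  proj_one : ∀ x, π (one x) = x
  proj_inv : ∀ γ, π (inv γ) = π γ
  mul_assoc : ∀ γ δ ε, π γ = π δ → π δ = π ε → mul (mul γ δ) ε = mul γ (mul δ ε)
  one_mul : ∀ γ, mul (one (π γ)) γ = γ
  mul_one : ∀ γ, mul γ (one (π γ)) = γ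
  inv_mul : ∀ γ, mul (inv γ) γ = one (π γ)
  mul_inv : ∀ γ, mul γ (inv γ) = one (π γ)
  exists_trivialization : ∀ x : M, ∃ e : Bundle.Trivialization G π,
    x ∈ e.baseSet ∧ IsSmoothTrivialization E𝒢 EM EG G e ∧
      ∀ γ δ, π γ ∈ e.baseSet → π γ = π δ → (e (mul γ δ)).2 = (e γ).2 * (e δ).2

end LieGroupBundles

section Actions

variable {EP E𝒢 EM EG : Type*}
  [NormedAddCommGroup EP] [NormedSpace ℝ EP]
  [NormedAddCommGroup E𝒢] [NormedSpace ℝ E𝒢]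
  [NormedAddCommGroup EM] [NormedSpace ℝ EM]
  [NormedAddCommGroup EG] [NormedSpace ℝ EG]
  {P 𝒢 M G : Type*}
  [TopologicalSpace P] [ChartedSpace EP P]
  [TopologicalSpace 𝒢] [ChartedSpace E𝒢 𝒢]
  [TopologicalSpace M] [ChartedSpace EM M]
  [TopologicalSpace G] [ChartedSpace EG G] [Group G]
  {π𝒢 : 𝒢 → M}

/-- The fibered product `P ×_M 𝒢`, as an (embedded) subset of `P × 𝒢`. -/
def fiberedProduct (πP : P → M) (π𝒢 : 𝒢 → M) : Set (P × 𝒢) :=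
  {x | πP x.1 = π𝒢 x.2}

variable (EP) in
/-- A smooth right fibered action `Φ : P ×_M 𝒢 → P` of a Lie group fiber bundle on `πP : P → M`.
The values of `act` off the fibered product are irrelevant. The fibered product is an embedded
submanifold of `P × 𝒢`, on which smoothness for the submanifold structure is `ContMDiffOn`. -/
structure FiberedAction (πP : P → M) (𝔊 : LieGroupFiberBundle E𝒢 EM EG G π𝒢) where
  act : P → 𝒢 → P
  contMDiffOn_act : ContMDiffOn (𝓘(ℝ, EP).prod 𝓘(ℝ, E𝒢)) 𝓘(ℝ, EP) ∞
    (fun x : P × 𝒢 => act x.1 x.2) (fiberedProduct πP π𝒢)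
  proj_act : ∀ p γ, πP p = π𝒢 γ → πP (act p γ) = πP p
  act_one : ∀ p, act p (𝔊.one (πP p)) = p
  act_mul : ∀ p γ δ, πP p = π𝒢 γ → πP p = π𝒢 δ → act p (𝔊.mul γ δ) = act (act p γ) δ

namespace FiberedAction

variable {πP : P → M} {𝔊 : LieGroupFiberBundle E𝒢 EM EG G π𝒢} (Φ : FiberedAction EP πP 𝔊)

/-- The fibered action is free. -/
def IsFree : Prop :=
  ∀ p γ, πP p = π𝒢 γ → Φ.act p γ = p → γ = 𝔊.one (πP p)

/-- The fibered action is proper: under `P ×_M 𝒢 → P ×_M P`, `(p, γ) ↦ (p, Φ (p, γ))`, the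
preimage of every compact set is compact. -/
def IsProper : Prop :=
  ∀ K : Set (P × P), K ⊆ fiberedProduct πP πP → IsCompact K →
    IsCompact {x : P × 𝒢 | x ∈ fiberedProduct πP π𝒢 ∧ (x.1, Φ.act x.1 x.2) ∈ K}

/-- Two points of `P` are equivalent if they lie in the same orbit of the fibered action. -/
def orbitSetoid : Setoid P where
  r p q := ∃ γ, πP p = π𝒢 γ ∧ Φ.act p γ = q
  iseqv :=
    { refl := fun p => ⟨𝔊.one (πP p), (𝔊.proj_one _).symm, Φ.act_one p⟩
      symm := by
        rintro p _ ⟨γ, hγ, rfl⟩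
        refine ⟨𝔊.inv γ, by rw [Φ.proj_act p γ hγ, 𝔊.proj_inv, hγ], ?_⟩
        rw [← Φ.act_mul p γ _ hγ (by rw [𝔊.proj_inv, hγ]), 𝔊.mul_inv, ← hγ, Φ.act_one]
      trans := by
        rintro p _ _ ⟨γ, hγ, rfl⟩ ⟨δ, hδ, rfl⟩
        have hδ' : πP p = π𝒢 δ := by rw [← hδ, Φ.proj_act p γ hγ]
        have hγδ : π𝒢 γ = π𝒢 δ := hγ.symm.trans hδ'
        exact ⟨𝔊.mul γ δ, by rw [𝔊.proj_mul γ δ hγδ, hγ], Φ.act_mul p γ δ hγ hδ'⟩ }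

/-- The orbit space `𝒮 = P / 𝒢`, which carries the quotient topology. -/
abbrev OrbitSpace : Type _ := Quotient Φ.orbitSetoid

/-- The canonical projection `P → 𝒮`. -/
def toOrbitSpace (p : P) : Φ.OrbitSpace := Quotient.mk Φ.orbitSetoid p

/-- The projection `𝒮 → M` induced by `πP : P → M`. -/
def orbitSpaceProj : Φ.OrbitSpace → M :=
  Quotient.lift πP (by
    rintro p _ ⟨γ, hγ, rfl⟩
    exact (Φ.proj_act p γ hγ).symm)

/-!
In the following definitions the tangent map of a smooth map defined on an embedded submanifold
`N` is the derivative within the set `N`. It is only ever applied to vectors tangent to `N`, on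
which all derivatives within `N` agree. Tangent spaces at two points that are equal, but not
syntactically so, are identified.
-/

/-- The tangent map `T_{(p, γ)} Φ (z, v)` of `Φ : P ×_M 𝒢 → P`, for
`(z, v) ∈ T_{(p, γ)} (P ×_M 𝒢) = T_p P ×_{T_x M} T_γ 𝒢`. -/
def tangentAct (p : P) (γ : 𝒢) (z : TangentSpace 𝓘(ℝ, EP) p) (v : TangentSpace 𝓘(ℝ, E𝒢) γ) :
    TangentSpace 𝓘(ℝ, EP) (Φ.act p γ) :=
  mfderivWithin (𝓘(ℝ, EP).prod 𝓘(ℝ, E𝒢)) 𝓘(ℝ, EP) (fun x : P × 𝒢 => Φ.act x.1 x.2)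
    (fiberedProduct πP π𝒢) (p, γ) (z, v)

/-- The tangent map at `p` of `Φ_γ : P_x → P_x`, `q ↦ Φ (q, γ)`, where `γ ∈ 𝒢_x`. -/
def tangentActRight (γ : 𝒢) (p : P) (z : TangentSpace 𝓘(ℝ, EP) p) :
    TangentSpace 𝓘(ℝ, EP) (Φ.act p γ) :=
  mfderivWithin 𝓘(ℝ, EP) 𝓘(ℝ, EP) (fun q : P => Φ.act q γ) {q | πP q = π𝒢 γ} p z

/-- The value at `p ∈ P_x` of the generalized fundamental field of `ξ ∈ T_{e_x} 𝒢_x`, i.e.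
the image of `ξ` under the tangent map at `e_x` of `Φ_p : 𝒢_x → P_x`, `δ ↦ Φ (p, δ)`. -/
def fundamentalField (p : P) (ξ : TangentSpace 𝓘(ℝ, E𝒢) (𝔊.one (πP p))) :
    TangentSpace 𝓘(ℝ, EP) p :=
  mfderivWithin 𝓘(ℝ, E𝒢) 𝓘(ℝ, EP) (fun δ : 𝒢 => Φ.act p δ) {δ | π𝒢 δ = πP p}
    (𝔊.one (πP p)) ξ

end FiberedAction

/-- The tangent map at `γ` of the left translation `L_{γ⁻¹} : 𝒢_x → 𝒢_x`, `δ ↦ γ⁻¹ · δ`, where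
`γ ∈ 𝒢_x`. -/
def LieGroupFiberBundle.tangentLeftInv (𝔊 : LieGroupFiberBundle E𝒢 EM EG G π𝒢) (γ : 𝒢)
    (v : TangentSpace 𝓘(ℝ, E𝒢) γ) : TangentSpace 𝓘(ℝ, E𝒢) (𝔊.one (π𝒢 γ)) :=
  mfderivWithin 𝓘(ℝ, E𝒢) 𝓘(ℝ, E𝒢) (fun δ : 𝒢 => 𝔊.mul (𝔊.inv γ) δ) {δ | π𝒢 δ = π𝒢 γ} γ v

/-- `τ` is a generalized principal connection associated to the connection `ν` on `𝒢`: for all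
`(p, γ) ∈ P ×_M 𝒢` and `(z, v) ∈ T_p P ×_{T_x M} T_γ 𝒢`,
`τ_{Φ(p,γ)} (TΦ (z, v)) = T_p Φ_γ (τ_p z) + (T_γ L_{γ⁻¹} (ν_γ v))^*_{Φ(p,γ)}`, with
`τ` and `ν` regarded as vertical projections. -/
def IsGeneralizedPrincipalConnection {ES : Type*} [NormedAddCommGroup ES] [NormedSpace ℝ ES]
    [IsManifold 𝓘(ℝ, EP) ∞ P] [IsManifold 𝓘(ℝ, E𝒢) ∞ 𝒢]
    {πP : P → M} {𝔊 : LieGroupFiberBundle E𝒢 EM EG G π𝒢} (Φ : FiberedAction EP πP 𝔊)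
    [ChartedSpace ES Φ.OrbitSpace]
    {hS : IsSmoothFiberBundle EP ES EG G Φ.toOrbitSpace}
    (ν : Connection 𝔊.isFiberBundle) (τ : Connection hS) : Prop :=
  ∀ (p : P) (γ : 𝒢), πP p = π𝒢 γ →
    ∀ (z : TangentSpace 𝓘(ℝ, EP) p) (v : TangentSpace 𝓘(ℝ, E𝒢) γ),
      (mfderiv 𝓘(ℝ, EP) 𝓘(ℝ, EM) πP p z : EM) = mfderiv 𝓘(ℝ, E𝒢) 𝓘(ℝ, EM) π𝒢 γ v →
      τ.vert (Φ.act p γ) (Φ.tangentAct p γ z v) =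
        Φ.tangentActRight γ p (τ.vert p z) +
          Φ.fundamentalField (Φ.act p γ) (𝔊.tangentLeftInv γ (ν.vert γ v))

end Actions

end GenPrincipal

end

open scoped Manifold ContDiff Topology

noncomputable section

namespace GenPrincipal

/-! ### Adapting maps to a fiber bundle; the horizontal-vertical splitting -/

section FiberBundles

variable {EQ EB EF : Type*}
  [NormedAddCommGroup EQ] [NormedSpace ℝ EQ]
  [NormedAddCommGroup EB] [NormedSpace ℝ EB]
  [NormedAddCommGroup EF] [NormedSpace ℝ EF]
  {Q B F : Type*}
  [TopologicalSpace Q] [ChartedSpace EQ Q]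
  [TopologicalSpace B] [ChartedSpace EB B]
  [TopologicalSpace F] [ChartedSpace EF F]
  {π : Q → B}

/-! Put `a = Tπ_{P,𝒮} z` and let `b` be the common projection of `z` and `v` to `TM`. Splitting `z`
and `v` into horizontal and vertical parts gives `TΦ(z, v) = TΦ(τ_p a, η_γ b) + TΦ(ω z, 0) + TΦ(0, ν
v)`. The last two terms are exactly the right side of the defining identity
(`tangentAct_zero_right`, `tangentAct_zero_left`). Since `Φ` preserves orbits, `Tπ_{P,𝒮} (TΦ(z, v))
= Tπ_{P,𝒮} z` (`mfderiv_toOrbitSpace_tangentAct`), so both terms are vertical over `𝒮` and fixed by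
`ω`. The identity therefore says that `TΦ(τ_p a, η_γ b)` is horizontal; as it projects to `a`, this
means that it is the horizontal lift of `a`.

The technical point is that `TΦ` and its partial versions are derivatives within subsets, determined
only on tangent vectors of those subsets. They are compared by composing with maps from open sets
into the subsets, whose derivatives fix the relevant vectors; `exists_hasMFDerivAt_over` supplies
these maps, and the composites have unique derivatives. -/

/-- Chain rule for a map differentiable within `s` and a map with values in `s`. -/
theorem hasMFDerivAt_comp_of_eventually_mem
    {E₁ H₁ M₁ E₂ H₂ M₂ E₃ H₃ M₃ : Type*}
    [NormedAddCommGroup E₁] [NormedSpace ℝ E₁] [TopologicalSpace H₁] [TopologicalSpace M₁]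
    [ChartedSpace H₁ M₁] {I₁ : ModelWithCorners ℝ E₁ H₁}
    [NormedAddCommGroup E₂] [NormedSpace ℝ E₂] [TopologicalSpace H₂] [TopologicalSpace M₂]
    [ChartedSpace H₂ M₂] {I₂ : ModelWithCorners ℝ E₂ H₂}
    [NormedAddCommGroup E₃] [NormedSpace ℝ E₃] [TopologicalSpace H₃] [TopologicalSpace M₃]
    [ChartedSpace H₃ M₃] {I₃ : ModelWithCorners ℝ E₃ H₃}
    {f : M₂ → M₃} {g : M₁ → M₂} {s : Set M₂} {c : M₁} {a : M₂}
    {f' : E₂ →L[ℝ] E₃} {g' : E₁ →L[ℝ] E₂}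
    (hf : HasMFDerivWithinAt I₂ I₃ f s a f') (hg : HasMFDerivAt I₁ I₂ g c g')
    (ha : g c = a) (hs : ∀ᶠ y in 𝓝 c, g y ∈ s) :
    HasMFDerivAt I₁ I₃ (f ∘ g) c (f'.comp g' : E₁ →L[ℝ] E₃) := by
  subst ha
  exact (HasMFDerivWithinAt.comp c hf (hg.hasMFDerivWithinAt (s := g ⁻¹' s))
    subset_rfl).hasMFDerivAt hs

/-- In a smooth fiber bundle, a map `g` to the total space can be modified to a map `ρ` lying over
a prescribed map `b` to the base; the derivative is unchanged in directions in which `g` already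
lies over `b` to first order. -/
theorem IsSmoothFiberBundle.exists_hasMFDerivAt_over
    (h : IsSmoothFiberBundle EQ EB EF F π)
    {EC HC C : Type*} [NormedAddCommGroup EC] [NormedSpace ℝ EC] [TopologicalSpace HC]
    [TopologicalSpace C] [ChartedSpace HC C] {IC : ModelWithCorners ℝ EC HC}
    {g : C → Q} {b : C → B} {c : C} {g' : EC →L[ℝ] EQ} {b' : EC →L[ℝ] EB}
    (hg : HasMFDerivAt IC 𝓘(ℝ, EQ) g c g') (hb : HasMFDerivAt IC 𝓘(ℝ, EB) b c b')
    (hc : π (g c) = b c) :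
    ∃ (ρ : C → Q) (ρ' : EC →L[ℝ] EQ), HasMFDerivAt IC 𝓘(ℝ, EQ) ρ c ρ' ∧ ρ c = g c ∧
      (∀ᶠ y in 𝓝 c, π (ρ y) = b y) ∧
      ∀ w : EC, (mfderiv 𝓘(ℝ, EQ) 𝓘(ℝ, EB) π (g c) (g' w) : EB) = b' w → ρ' w = g' w := by
  obtain ⟨e, heb, he⟩ := h.exists_trivialization (π (g c))
  have hsrc : g c ∈ e.source := e.mem_source.2 heb
  have htgt : e (g c) ∈ e.target := e.toOpenPartialHomeomorph.map_source hsrc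
  have hD : HasMFDerivAt 𝓘(ℝ, EQ) (𝓘(ℝ, EB).prod 𝓘(ℝ, EF)) e (g c) _ :=
    ((he.contMDiffOn_toFun.contMDiffAt (e.open_source.mem_nhds hsrc)).mdifferentiableAt
      (by simp)).hasMFDerivAt
  have hS : HasMFDerivAt (𝓘(ℝ, EB).prod 𝓘(ℝ, EF)) 𝓘(ℝ, EQ) e.toOpenPartialHomeomorph.symm
      (e (g c)) _ :=
    ((he.contMDiffOn_symm.contMDiffAt (e.open_target.mem_nhds htgt)).mdifferentiableAt
      (by simp)).hasMFDerivAt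
  set D : EQ →L[ℝ] EB × EF := mfderiv 𝓘(ℝ, EQ) (𝓘(ℝ, EB).prod 𝓘(ℝ, EF)) e (g c) with hDdef
  set S : EB × EF →L[ℝ] EQ := mfderiv (𝓘(ℝ, EB).prod 𝓘(ℝ, EF)) 𝓘(ℝ, EQ)
    e.toOpenPartialHomeomorph.symm (e (g c)) with hSdef
  have hSD : ∀ u : EQ, S (D u) = u := by
    intro u
    have h1 : HasMFDerivAt 𝓘(ℝ, EQ) 𝓘(ℝ, EQ) (e.toOpenPartialHomeomorph.symm ∘ e) (g c)
      (S.comp D : EQ →L[ℝ] EQ) := HasMFDerivAt.comp (g c) hS hD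
    have h2 : (e.toOpenPartialHomeomorph.symm ∘ e) =ᶠ[𝓝 (g c)] id := by
      filter_upwards [e.open_source.mem_nhds hsrc] with y hy
      exact e.toOpenPartialHomeomorph.left_inv hy
    have h3 := hasMFDerivAt_unique (h1.congr_of_eventuallyEq h2.symm) (hasMFDerivAt_id (g c))
    exact congrArg (fun L : EQ →L[ℝ] EQ => L u) h3
  have hD1 : ∀ u : EQ, (D u).1 = (mfderiv 𝓘(ℝ, EQ) 𝓘(ℝ, EB) π (g c) u : EB) := by
    intro u
    have h1 : HasMFDerivAt 𝓘(ℝ, EQ) 𝓘(ℝ, EB) (Prod.fst ∘ e) (g c)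
      ((ContinuousLinearMap.fst ℝ EB EF).comp D : EQ →L[ℝ] EB) :=
      HasMFDerivAt.comp (g c) (hasMFDerivAt_fst (e (g c))) hD
    have h2 : (Prod.fst ∘ e) =ᶠ[𝓝 (g c)] π := by
      filter_upwards [e.open_source.mem_nhds hsrc] with y hy
      exact e.coe_fst hy
    have h3 := (h1.congr_of_eventuallyEq h2.symm).mfderiv
    exact (congrArg (fun L : EQ →L[ℝ] EB => L u) h3).symm
  have hf : HasMFDerivAt IC 𝓘(ℝ, EF) (fun y => (e (g y)).2) c
      ((ContinuousLinearMap.snd ℝ EB EF).comp (D.comp g') : EC →L[ℝ] EF) :=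
    HasMFDerivAt.comp c (hasMFDerivAt_snd (e (g c))) (HasMFDerivAt.comp c hD hg)
  have hbf : HasMFDerivAt IC (𝓘(ℝ, EB).prod 𝓘(ℝ, EF)) (fun y => (b y, (e (g y)).2)) c
      (b'.prod ((ContinuousLinearMap.snd ℝ EB EF).comp (D.comp g')) : EC →L[ℝ] EB × EF) :=
    HasMFDerivAt.prodMk hb hf
  have hval : (b c, (e (g c)).2) = e (g c) := by
    rw [← hc]
    exact Prod.ext (e.coe_fst hsrc).symm rfl
  -- In the trivialization, keep the fiber component of `g` and replace its base component by `b`.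
  refine ⟨fun y => e.toOpenPartialHomeomorph.symm (b y, (e (g y)).2),
    S.comp (b'.prod ((ContinuousLinearMap.snd ℝ EB EF).comp (D.comp g'))),
    hasMFDerivAt_comp_of_eventually_mem (s := Set.univ) hS.hasMFDerivWithinAt hbf hval
      (by simp), ?_, ?_, ?_⟩
  · change e.toOpenPartialHomeomorph.symm (b c, (e (g c)).2) = g c
    rw [hval]
    exact e.toOpenPartialHomeomorph.left_inv hsrc
  · filter_upwards [hb.continuousAt.preimage_mem_nhds
      (e.open_baseSet.mem_nhds (hc ▸ heb))] with y hy
    exact e.proj_symm_apply' hy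
  · intro w hw
    have h1 : ((b' w, (D (g' w)).2) : EB × EF) = D (g' w) :=
      Prod.ext (by rw [hD1]; exact hw.symm) rfl
    change S (b' w, (D (g' w)).2) = g' w
    rw [h1, hSD]

/-- A map on the base of a smooth fiber bundle is differentiable if its composition with the
projection is, at points of the image of the projection. -/
theorem IsSmoothFiberBundle.mdifferentiableAt_of_comp
    (h : IsSmoothFiberBundle EQ EB EF F π)
    {EN N : Type*} [NormedAddCommGroup EN] [NormedSpace ℝ EN] [TopologicalSpace N]
    [ChartedSpace EN N] {f : B → N} {q : Q} (hf : MDifferentiable 𝓘(ℝ, EQ) 𝓘(ℝ, EN) (f ∘ π)) :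
    MDifferentiableAt 𝓘(ℝ, EB) 𝓘(ℝ, EN) f (π q) := by
  -- Moving the constant map `q` over the identity of `B` yields a local section `ρ`, and `f = (f ∘
  -- π) ∘ ρ` near `π q`.
  obtain ⟨ρ, ρ', hρ, -, hπ, -⟩ := h.exists_hasMFDerivAt_over (IC := 𝓘(ℝ, EB)) (c := π q)
    (g := fun _ => q) (b := id) (hasMFDerivAt_const q (π q)) (hasMFDerivAt_id (π q)) rfl
  refine ((hf (ρ (π q))).comp (π q) hρ.mdifferentiableAt).congr_of_eventuallyEq ?_
  filter_upwards [hπ] with y hy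
  exact congrArg f hy.symm

namespace Connection

variable [IsManifold 𝓘(ℝ, EQ) ∞ Q] {h : IsSmoothFiberBundle EQ EB EF F π} (ν : Connection h)

theorem vert_horizontalLift (q : Q) (a : TangentSpace 𝓘(ℝ, EB) (π q)) :
    ν.vert q (ν.horizontalLift q a) = 0 :=
  ((LinearEquiv.ofBijective (ν.projHor q) (ν.bijective_projHor q)).symm a).2

theorem mfderiv_horizontalLift (q : Q) (a : TangentSpace 𝓘(ℝ, EB) (π q)) :
    mfderiv 𝓘(ℝ, EQ) 𝓘(ℝ, EB) π q (ν.horizontalLift q a) = a :=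
  (LinearEquiv.ofBijective (ν.projHor q) (ν.bijective_projHor q)).apply_symm_apply a

/-- The difference of the two sides is vertical, hence fixed by `ν`, yet `ν` kills it. -/
theorem eq_horizontalLift {q : Q} {z : TangentSpace 𝓘(ℝ, EQ) q}
    {a : TangentSpace 𝓘(ℝ, EB) (π q)} (hz : ν.vert q z = 0)
    (ha : mfderiv 𝓘(ℝ, EQ) 𝓘(ℝ, EB) π q z = a) : z = ν.horizontalLift q a := by
  have h1 : ν.vert q (z - ν.horizontalLift q a) = z - ν.horizontalLift q a :=
    ν.vert_eq_self q _ (by rw [map_sub, ν.mfderiv_horizontalLift, ha, sub_self])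
  rw [map_sub, hz, ν.vert_horizontalLift, sub_zero] at h1
  exact sub_eq_zero.1 h1.symm

theorem horizontalLift_add_vert (q : Q) (z : TangentSpace 𝓘(ℝ, EQ) q) :
    ν.horizontalLift q (mfderiv 𝓘(ℝ, EQ) 𝓘(ℝ, EB) π q z) + ν.vert q z = z := by
  have h1 : ν.vert q (ν.vert q z) = ν.vert q z := ν.vert_eq_self q _ (ν.mfderiv_vert q z)
  rw [← ν.eq_horizontalLift (z := z - ν.vert q z) (by rw [map_sub, h1, sub_self])
    (by rw [map_sub, ν.mfderiv_vert, sub_zero]), sub_add_cancel]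

end Connection

end FiberBundles

/-! ### The tangent map of the fibered action -/

section Actions

variable {EP E𝒢 EM EF EG : Type*}
  [NormedAddCommGroup EP] [NormedSpace ℝ EP]
  [NormedAddCommGroup E𝒢] [NormedSpace ℝ E𝒢]
  [NormedAddCommGroup EM] [NormedSpace ℝ EM]
  [NormedAddCommGroup EF] [NormedSpace ℝ EF]
  [NormedAddCommGroup EG] [NormedSpace ℝ EG]
  {P 𝒢 M F G : Type*}
  [TopologicalSpace P] [ChartedSpace EP P]
  [TopologicalSpace 𝒢] [ChartedSpace E𝒢 𝒢]
  [TopologicalSpace M] [ChartedSpace EM M]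
  [TopologicalSpace F] [ChartedSpace EF F]
  [TopologicalSpace G] [ChartedSpace EG G] [Group G]
  {πP : P → M} {π𝒢 : 𝒢 → M}

/-- Left translation by an element of a fiber is differentiable along the fiber. -/
theorem LieGroupFiberBundle.mdifferentiableWithinAt_mul_left [LieGroup 𝓘(ℝ, EG) ∞ G]
    (𝔊 : LieGroupFiberBundle E𝒢 EM EG G π𝒢) {α γ : 𝒢} (hα : π𝒢 α = π𝒢 γ) :
    MDifferentiableWithinAt 𝓘(ℝ, E𝒢) 𝓘(ℝ, E𝒢) (fun δ => 𝔊.mul α δ) {δ | π𝒢 δ = π𝒢 γ} γ := by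
  obtain ⟨e, heb, he, hmul⟩ := 𝔊.exists_trivialization (π𝒢 γ)
  have hsub : {δ | π𝒢 δ = π𝒢 γ} ⊆ e.source := fun δ hδ => e.mem_source.2 (by rwa [hδ])
  have h1 : ContMDiffOn 𝓘(ℝ, E𝒢) 𝓘(ℝ, EG) ∞ (fun δ => (e α).2 * (e δ).2)
      {δ | π𝒢 δ = π𝒢 γ} :=
    (contMDiff_mul_left (I := 𝓘(ℝ, EG)) (n := ∞) (a := (e α).2)).comp_contMDiffOn
      (contMDiff_snd.comp_contMDiffOn (he.contMDiffOn_toFun.mono hsub))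
  -- In a multiplicative trivialization, left translation by `α` becomes left multiplication by `(e
  -- α).2` in `G`, with constant base component.
  have h2 : ContMDiffOn 𝓘(ℝ, E𝒢) 𝓘(ℝ, E𝒢) ∞
      (fun δ => e.toOpenPartialHomeomorph.symm (π𝒢 γ, (e α).2 * (e δ).2))
      {δ | π𝒢 δ = π𝒢 γ} :=
    he.contMDiffOn_symm.comp (contMDiffOn_const.prodMk h1) fun δ _ => e.mem_target.2 heb
  refine ((h2 γ rfl).mdifferentiableWithinAt (by simp)).congr (fun δ hδ => ?_) ?_ <;>
  · have hαδ : π𝒢 α = π𝒢 _ := hα.trans (Eq.symm (by first | exact hδ | rfl))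
    have hp := (𝔊.proj_mul _ _ hαδ).trans hα
    rw [← hmul _ _ (hα ▸ heb) hαδ, ← hp]
    exact (e.symm_apply_mk_proj (e.mem_source.2 (hp ▸ heb))).symm

namespace FiberedAction

variable {𝔊 : LieGroupFiberBundle E𝒢 EM EG G π𝒢} (Φ : FiberedAction EP πP 𝔊)

theorem hasMFDerivWithinAt_act {p : P} {γ : 𝒢} (hx : πP p = π𝒢 γ) :
    HasMFDerivWithinAt (𝓘(ℝ, EP).prod 𝓘(ℝ, E𝒢)) 𝓘(ℝ, EP) (fun x : P × 𝒢 => Φ.act x.1 x.2)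
      (fiberedProduct πP π𝒢) (p, γ)
      (mfderivWithin (𝓘(ℝ, EP).prod 𝓘(ℝ, E𝒢)) 𝓘(ℝ, EP) (fun x : P × 𝒢 => Φ.act x.1 x.2)
        (fiberedProduct πP π𝒢) (p, γ)) :=
  ((Φ.contMDiffOn_act (p, γ) hx).mdifferentiableWithinAt (by simp)).hasMFDerivWithinAt

variable {EC HC C : Type*} [NormedAddCommGroup EC] [NormedSpace ℝ EC] [TopologicalSpace HC]
  [TopologicalSpace C] [ChartedSpace HC C] {IC : ModelWithCorners ℝ EC HC}

/-- Chain rule for the composition of the action with a map into the fibered product. -/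
theorem exists_hasMFDerivAt_act {u : C → P} {k : C → 𝒢} {c : C} {p : P} {γ : 𝒢}
    {u' : EC →L[ℝ] EP} {k' : EC →L[ℝ] E𝒢}
    (hu : HasMFDerivAt IC 𝓘(ℝ, EP) u c u') (hk : HasMFDerivAt IC 𝓘(ℝ, E𝒢) k c k')
    (hup : u c = p) (hkγ : k c = γ) (hx : πP p = π𝒢 γ)
    (huk : ∀ᶠ y in 𝓝 c, πP (u y) = π𝒢 (k y)) :
    ∃ D : EC →L[ℝ] EP, HasMFDerivAt IC 𝓘(ℝ, EP) (fun y => Φ.act (u y) (k y)) c D ∧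
      ∀ w, D w = Φ.tangentAct p γ (u' w) (k' w) := by
  have huk' : HasMFDerivAt IC (𝓘(ℝ, EP).prod 𝓘(ℝ, E𝒢)) (fun y => (u y, k y)) c
      (u'.prod k' : EC →L[ℝ] EP × E𝒢) := HasMFDerivAt.prodMk hu hk
  exact ⟨_, hasMFDerivAt_comp_of_eventually_mem (Φ.hasMFDerivWithinAt_act hx) huk'
    (by rw [hup, hkγ]) huk, fun w => rfl⟩

/-- No tangency condition is needed: the derivative within the fibered product is a linear map on
all of `EP × E𝒢`. -/
theorem tangentAct_add (p : P) (γ : 𝒢) (z z' : EP) (v v' : E𝒢) :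
    (Φ.tangentAct p γ (z + z') (v + v') : EP) =
      (Φ.tangentAct p γ z v : EP) + (Φ.tangentAct p γ z' v' : EP) := by
  exact map_add (mfderivWithin (𝓘(ℝ, EP).prod 𝓘(ℝ, E𝒢)) 𝓘(ℝ, EP)
    (fun x : P × 𝒢 => Φ.act x.1 x.2) (fiberedProduct πP π𝒢) (p, γ))
    (z, v) (z', v')

/-- The action preserves the orbits, infinitesimally: `T π_{P,𝒮} (T Φ (z, v)) = T π_{P,𝒮} z`. -/
theorem mfderiv_toOrbitSpace_tangentAct (hP : IsSmoothFiberBundle EP EM EF F πP)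
    {ES : Type*} [NormedAddCommGroup ES] [NormedSpace ℝ ES] [ChartedSpace ES Φ.OrbitSpace]
    (hS : IsSmoothFiberBundle EP ES EG G Φ.toOrbitSpace)
    {p : P} {γ : 𝒢} (hx : πP p = π𝒢 γ) (z : EP) (v : E𝒢)
    (hzv : (mfderiv 𝓘(ℝ, EP) 𝓘(ℝ, EM) πP p z : EM) = mfderiv 𝓘(ℝ, E𝒢) 𝓘(ℝ, EM) π𝒢 γ v) :
    (mfderiv 𝓘(ℝ, EP) 𝓘(ℝ, ES) Φ.toOrbitSpace (Φ.act p γ) (Φ.tangentAct p γ z v) : ES) =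
      mfderiv 𝓘(ℝ, EP) 𝓘(ℝ, ES) Φ.toOrbitSpace p z := by
  have hfst := hasMFDerivAt_fst (I := 𝓘(ℝ, EP)) (I' := 𝓘(ℝ, E𝒢)) (p, γ)
  have hsnd := hasMFDerivAt_snd (I := 𝓘(ℝ, EP)) (I' := 𝓘(ℝ, E𝒢)) (p, γ)
  have hπ𝒢 : HasMFDerivAt 𝓘(ℝ, E𝒢) 𝓘(ℝ, EM) π𝒢 γ _ :=
    ((𝔊.isFiberBundle.contMDiff_proj γ).mdifferentiableAt (by simp)).hasMFDerivAt
  -- `y ↦ (ρ y, y.2)` sends a neighborhood of `(p, γ)` in `P × 𝒢` into `P ×_M 𝒢`, and its derivative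
  -- fixes the vectors tangent to `P ×_M 𝒢`.
  obtain ⟨ρ, ρ', hρ, hρp, hρ𝒢, hρ'⟩ := hP.exists_hasMFDerivAt_over hfst
    (HasMFDerivAt.comp (p, γ) hπ𝒢 hsnd) hx
  obtain ⟨D, hD, hD'⟩ := Φ.exists_hasMFDerivAt_act hρ hsnd hρp rfl hx hρ𝒢
  have hS' : ∀ q, HasMFDerivAt 𝓘(ℝ, EP) 𝓘(ℝ, ES) Φ.toOrbitSpace q
      (mfderiv 𝓘(ℝ, EP) 𝓘(ℝ, ES) Φ.toOrbitSpace q) := fun q =>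
    ((hS.contMDiff_proj q).mdifferentiableAt (by simp)).hasMFDerivAt
  have h1 := hasMFDerivAt_comp_of_eventually_mem (s := Set.univ)
    (hS' (Φ.act p γ)).hasMFDerivWithinAt hD (by rw [hρp]) (by simp)
  have h2 := hasMFDerivAt_comp_of_eventually_mem (s := Set.univ)
    (hS' p).hasMFDerivWithinAt hρ hρp (by simp)
  -- `Φ(ρ y, y.2)` and `ρ y` lie in the same orbit.
  have h3 : (Φ.toOrbitSpace ∘ fun y : P × 𝒢 => Φ.act (ρ y) y.2) =ᶠ[𝓝 (p, γ)]
      Φ.toOrbitSpace ∘ ρ := by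
    filter_upwards [hρ𝒢] with y hy
    exact (Quotient.sound (s := Φ.orbitSetoid) ⟨y.2, hy, rfl⟩).symm
  have h4 := hasMFDerivAt_unique h1 (h2.congr_of_eventuallyEq h3)
  have h5 := congrArg (fun L : EP × E𝒢 →L[ℝ] ES => L (z, v)) h4
  have h6 : ρ' (z, v) = z := hρ' (z, v) hzv
  have h7 : D (z, v) = Φ.tangentAct p γ z v := by
    rw [hD', h6]
    rfl
  change (mfderiv 𝓘(ℝ, EP) 𝓘(ℝ, ES) Φ.toOrbitSpace (Φ.act p γ) (D (z, v)) : ES) =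
    mfderiv 𝓘(ℝ, EP) 𝓘(ℝ, ES) Φ.toOrbitSpace p (ρ' (z, v)) at h5
  rwa [h6, h7] at h5

/-- On vertical vectors, `T Φ (z, 0) = T Φ_γ z`. -/
theorem tangentAct_zero_right (hP : IsSmoothFiberBundle EP EM EF F πP)
    {p : P} {γ : 𝒢} (hx : πP p = π𝒢 γ) (z : EP)
    (hz : (mfderiv 𝓘(ℝ, EP) 𝓘(ℝ, EM) πP p z : EM) = 0) :
    (Φ.tangentAct p γ z (0 : E𝒢) : EP) = Φ.tangentActRight γ p z := by
  -- `ρ` maps a neighborhood of `p` into the fiber `P_x`, with derivative fixing vertical vectors.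
  -- The derivative of `y ↦ Φ(ρ y, γ)` is then computed within `P ×_M 𝒢` and within `P_x`.
  obtain ⟨ρ, ρ', hρ, hρp, hρ𝒢, hρ'⟩ := hP.exists_hasMFDerivAt_over
    (IC := 𝓘(ℝ, EP)) (c := p) (hasMFDerivAt_id p) (hasMFDerivAt_const (π𝒢 γ) p) hx
  obtain ⟨D, hD, hD'⟩ := Φ.exists_hasMFDerivAt_act hρ
    (hasMFDerivAt_const (I' := 𝓘(ℝ, E𝒢)) γ p) hρp rfl hx hρ𝒢
  have h1 : MDifferentiableWithinAt 𝓘(ℝ, EP) 𝓘(ℝ, EP) (fun q => Φ.act q γ)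
      {q | πP q = π𝒢 γ} p :=
    ((Φ.contMDiffOn_act.comp (contMDiffOn_id.prodMk contMDiffOn_const)
      (fun q hq => hq)) p hx).mdifferentiableWithinAt (by simp)
  have h2 := hasMFDerivAt_comp_of_eventually_mem h1.hasMFDerivWithinAt hρ hρp hρ𝒢
  have h3 := congrArg (fun L : EP →L[ℝ] EP => L z) (hasMFDerivAt_unique hD h2)
  have h4 : ρ' z = z := hρ' z hz
  have h5 : D z = Φ.tangentAct p γ z (0 : E𝒢) := by
    rw [hD', h4]
    rfl
  change D z = Φ.tangentActRight γ p (ρ' z) at h3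
  rwa [h4, h5] at h3

/-- On vertical vectors, `T Φ (0, v)` is the fundamental field of `T L_{γ⁻¹} v`. -/
theorem tangentAct_zero_left [LieGroup 𝓘(ℝ, EG) ∞ G]
    {p : P} {γ : 𝒢} (hx : πP p = π𝒢 γ) (v : E𝒢)
    (hv : (mfderiv 𝓘(ℝ, E𝒢) 𝓘(ℝ, EM) π𝒢 γ v : EM) = 0) :
    (Φ.tangentAct p γ (0 : EP) v : EP) =
      Φ.fundamentalField (Φ.act p γ) (𝔊.tangentLeftInv γ v) := by
  obtain ⟨ρ, ρ', hρ, hργ, hρ𝒢, hρ'⟩ := 𝔊.isFiberBundle.exists_hasMFDerivAt_over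
    (IC := 𝓘(ℝ, E𝒢)) (c := γ) (hasMFDerivAt_id γ) (hasMFDerivAt_const (π𝒢 γ) γ) rfl
  obtain ⟨D, hD, hD'⟩ := Φ.exists_hasMFDerivAt_act
    (hasMFDerivAt_const (I' := 𝓘(ℝ, EP)) p γ) hρ rfl hργ hx
    (hρ𝒢.mono fun y hy => hx.trans hy.symm)
  have hpγ : πP (Φ.act p γ) = π𝒢 γ := (Φ.proj_act p γ hx).trans hx
  have hL := (𝔊.mdifferentiableWithinAt_mul_left (𝔊.proj_inv γ)).hasMFDerivWithinAt
  have h1 := hasMFDerivAt_comp_of_eventually_mem hL hρ hργ hρ𝒢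
  have h2 : MDifferentiableWithinAt 𝓘(ℝ, E𝒢) 𝓘(ℝ, EP) (fun δ => Φ.act (Φ.act p γ) δ)
      {δ | π𝒢 δ = πP (Φ.act p γ)} (𝔊.one (πP (Φ.act p γ))) :=
    ((Φ.contMDiffOn_act.comp (contMDiffOn_const.prodMk contMDiffOn_id)
      (fun δ hδ => Eq.symm hδ)) _ (𝔊.proj_one _)).mdifferentiableWithinAt (by simp)
  have h3 := hasMFDerivAt_comp_of_eventually_mem h2.hasMFDerivWithinAt h1
    (by
      change 𝔊.mul (𝔊.inv γ) (ρ γ) = _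
      rw [hργ, hpγ]
      exact 𝔊.inv_mul γ)
    (hρ𝒢.mono fun y hy => by
      change π𝒢 (𝔊.mul (𝔊.inv γ) (ρ y)) = _
      rw [𝔊.proj_mul _ _ ((𝔊.proj_inv γ).trans hy.symm), 𝔊.proj_inv, hpγ])
  -- On the fiber of `γ`, `Φ(p, δ) = Φ(Φ(p, γ), γ⁻¹ · δ)`; differentiating at `δ = γ` gives the
  -- claim.
  have h4 : (fun y => Φ.act p (ρ y)) =ᶠ[𝓝 γ]
      (fun δ => Φ.act (Φ.act p γ) δ) ∘ (fun δ => 𝔊.mul (𝔊.inv γ) δ) ∘ ρ := by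
    filter_upwards [hρ𝒢] with y hy
    change Φ.act p (ρ y) = Φ.act (Φ.act p γ) (𝔊.mul (𝔊.inv γ) (ρ y))
    have hy' : π𝒢 (𝔊.inv γ) = π𝒢 (ρ y) := (𝔊.proj_inv γ).trans hy.symm
    rw [← Φ.act_mul p _ _ hx (by rw [𝔊.proj_mul _ _ hy', 𝔊.proj_inv, hx]),
      ← 𝔊.mul_assoc _ _ _ (𝔊.proj_inv γ).symm hy', 𝔊.mul_inv, ← hy, 𝔊.one_mul]
  have h5 := congrArg (fun L : E𝒢 →L[ℝ] EP => L v)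
    (hasMFDerivAt_unique hD (h3.congr_of_eventuallyEq h4))
  have h6 : ρ' v = v := hρ' v hv
  have h7 : D v = Φ.tangentAct p γ (0 : EP) v := by
    rw [hD', h6]
    rfl
  change D v = Φ.fundamentalField (Φ.act p γ) (𝔊.tangentLeftInv γ (ρ' v)) at h5
  rwa [h6, h7] at h5

/-- The tangent map of `πP = π_{𝒮,M} ∘ π_{P,𝒮}`. -/
theorem mfderiv_orbitSpaceProj (hP : IsSmoothFiberBundle EP EM EF F πP)
    {ES : Type*} [NormedAddCommGroup ES] [NormedSpace ℝ ES] [ChartedSpace ES Φ.OrbitSpace]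
    (hS : IsSmoothFiberBundle EP ES EG G Φ.toOrbitSpace) (p : P) (z : EP) :
    (mfderiv 𝓘(ℝ, EP) 𝓘(ℝ, EM) πP p z : EM) =
      mfderiv 𝓘(ℝ, ES) 𝓘(ℝ, EM) Φ.orbitSpaceProj (Φ.toOrbitSpace p)
        (mfderiv 𝓘(ℝ, EP) 𝓘(ℝ, ES) Φ.toOrbitSpace p z) := by
  -- The composite is `πP` by definition, and its differentiability descends to `orbitSpaceProj`
  -- along local sections of `P → 𝒮`.
  have h1 : MDifferentiable 𝓘(ℝ, EP) 𝓘(ℝ, EM) (Φ.orbitSpaceProj ∘ Φ.toOrbitSpace) :=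
    hP.contMDiff_proj.mdifferentiable (by simp)
  have h2 := mfderiv_comp p (hS.mdifferentiableAt_of_comp (q := p) h1)
    ((hS.contMDiff_proj p).mdifferentiableAt (by simp))
  exact congrArg (fun L : EP →L[ℝ] EM => L z) h2

end FiberedAction

end Actions

end GenPrincipal

end

/-! ### The equivalence -/

theorem proposition7p4
    {EM EP E𝒢 EF EG ES : Type*}
    [NormedAddCommGroup EM] [NormedSpace ℝ EM] [FiniteDimensional ℝ EM]
    [NormedAddCommGroup EP] [NormedSpace ℝ EP] [FiniteDimensional ℝ EP]
    [NormedAddCommGroup E𝒢] [NormedSpace ℝ E𝒢] [FiniteDimensional ℝ E𝒢]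
    [NormedAddCommGroup EF] [NormedSpace ℝ EF] [FiniteDimensional ℝ EF]
    [NormedAddCommGroup EG] [NormedSpace ℝ EG] [FiniteDimensional ℝ EG]
    [NormedAddCommGroup ES] [NormedSpace ℝ ES] [FiniteDimensional ℝ ES]
    {M P 𝒢 F G : Type*}
    [TopologicalSpace M] [T2Space M] [ChartedSpace EM M] [IsManifold 𝓘(ℝ, EM) ∞ M]
    [TopologicalSpace P] [T2Space P] [ChartedSpace EP P] [IsManifold 𝓘(ℝ, EP) ∞ P]
    [TopologicalSpace 𝒢] [T2Space 𝒢] [ChartedSpace E𝒢 𝒢] [IsManifold 𝓘(ℝ, E𝒢) ∞ 𝒢]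
    [TopologicalSpace F] [T2Space F] [ChartedSpace EF F] [IsManifold 𝓘(ℝ, EF) ∞ F]
    [TopologicalSpace G] [T2Space G] [ChartedSpace EG G] [Group G] [LieGroup 𝓘(ℝ, EG) ∞ G]
    -- the fiber bundle `(P, M, πP, F)` and the Lie group fiber bundle `(𝒢, M, π𝒢, G)`
    {πP : P → M} (hP : GenPrincipal.IsSmoothFiberBundle EP EM EF F πP)
    {π𝒢 : 𝒢 → M} (𝔊 : GenPrincipal.LieGroupFiberBundle E𝒢 EM EG G π𝒢)
    -- the free and proper right fibered action `Φ : P ×_M 𝒢 → P`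
    (Φ : GenPrincipal.FiberedAction EP πP 𝔊) (hfree : Φ.IsFree) (hproper : Φ.IsProper)
    -- the smooth structure of `𝒮 = P / 𝒢` for which `(P, 𝒮, π_{P,𝒮}, G)` is a fiber bundle
    [ChartedSpace ES Φ.OrbitSpace] [IsManifold 𝓘(ℝ, ES) ∞ Φ.OrbitSpace]
    (hS : GenPrincipal.IsSmoothFiberBundle EP ES EG G Φ.toOrbitSpace)
    -- connections on `(𝒢, M, π𝒢, G)` and on `(P, 𝒮, π_{P,𝒮}, G)`
    (η : GenPrincipal.Connection 𝔊.isFiberBundle) (τ : GenPrincipal.Connection hS) :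
    GenPrincipal.IsGeneralizedPrincipalConnection Φ η τ ↔
      ∀ (p : P) (γ : 𝒢), πP p = π𝒢 γ →
        ∀ a : TangentSpace 𝓘(ℝ, ES) (Φ.toOrbitSpace p),
          τ.horizontalLift (Φ.act p γ) a =
            Φ.tangentAct p γ (τ.horizontalLift p a)
              (η.horizontalLift γ
                (mfderiv 𝓘(ℝ, ES) 𝓘(ℝ, EM) Φ.orbitSpaceProj (Φ.toOrbitSpace p) a)) := by
  constructor
  · intro H p γ hx a
    -- The pair of horizontal lifts is tangent to `P ×_M 𝒢`. The defining identity applies to it,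
    -- with vanishing right side.
    have hcomp : (mfderiv 𝓘(ℝ, EP) 𝓘(ℝ, EM) πP p (τ.horizontalLift p a) : EM) =
        mfderiv 𝓘(ℝ, E𝒢) 𝓘(ℝ, EM) π𝒢 γ (η.horizontalLift γ
          (mfderiv 𝓘(ℝ, ES) 𝓘(ℝ, EM) Φ.orbitSpaceProj (Φ.toOrbitSpace p) a)) :=
      ((Φ.mfderiv_orbitSpaceProj hP hS p _).trans (congrArg
        (mfderiv 𝓘(ℝ, ES) 𝓘(ℝ, EM) Φ.orbitSpaceProj (Φ.toOrbitSpace p))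
        (τ.mfderiv_horizontalLift p a))).trans (η.mfderiv_horizontalLift γ _).symm
    refine (τ.eq_horizontalLift ((H p γ hx _ _ hcomp).trans ?_) ?_).symm
    · have h1 : Φ.tangentActRight γ p (τ.vert p (τ.horizontalLift p a)) = 0 :=
        (congrArg (Φ.tangentActRight γ p) (τ.vert_horizontalLift p a)).trans
          (map_zero (mfderivWithin _ _ _ _ _))
      have h2 : 𝔊.tangentLeftInv γ (η.vert γ (η.horizontalLift γ
          (mfderiv 𝓘(ℝ, ES) 𝓘(ℝ, EM) Φ.orbitSpaceProj (Φ.toOrbitSpace p) a))) = 0 :=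
        (congrArg (𝔊.tangentLeftInv γ) (η.vert_horizontalLift γ _)).trans
          (map_zero (mfderivWithin _ _ _ _ _))
      exact (congrArg₂ (· + ·) h1 ((congrArg (Φ.fundamentalField (Φ.act p γ)) h2).trans
        (map_zero (mfderivWithin _ _ _ _ _)))).trans (zero_add _)
    · exact (Φ.mfderiv_toOrbitSpace_tangentAct hP hS hx _ _ hcomp).trans
        (τ.mfderiv_horizontalLift p a)
  · intro H p γ hx z v hzv
    set a := mfderiv 𝓘(ℝ, EP) 𝓘(ℝ, ES) Φ.toOrbitSpace p z with ha
    have hb : (mfderiv 𝓘(ℝ, ES) 𝓘(ℝ, EM) Φ.orbitSpaceProj (Φ.toOrbitSpace p) a : EM) =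
        mfderiv 𝓘(ℝ, E𝒢) 𝓘(ℝ, EM) π𝒢 γ v :=
      (Φ.mfderiv_orbitSpaceProj hP hS p z).symm.trans hzv
    -- Vertical over `𝒮` implies vertical over `M`.
    have hz0 : (mfderiv 𝓘(ℝ, EP) 𝓘(ℝ, EM) πP p (τ.vert p z) : EM) = 0 :=
      (Φ.mfderiv_orbitSpaceProj hP hS p _).trans ((congrArg
        (mfderiv 𝓘(ℝ, ES) 𝓘(ℝ, EM) Φ.orbitSpaceProj (Φ.toOrbitSpace p))
        (τ.mfderiv_vert p z)).trans (map_zero _))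
    have hv0 := η.mfderiv_vert γ v
    have hR := Φ.tangentAct_zero_right hP hx (τ.vert p z) hz0
    have hL := Φ.tangentAct_zero_left hx (η.vert γ v) hv0
    have hH := H p γ hx a
    -- The three-term splitting of `TΦ(z, v)`, its horizontal term rewritten by the lift formula.
    have hsplit : (Φ.tangentAct p γ z v : EP) =
        (τ.horizontalLift (Φ.act p γ) a : EP) +
          ((Φ.tangentActRight γ p (τ.vert p z) : EP) +
            (Φ.fundamentalField (Φ.act p γ) (𝔊.tangentLeftInv γ (η.vert γ v)) : EP)) := by
      have hzs : z = (τ.horizontalLift p a : EP) + ((τ.vert p z : EP) + 0) :=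
        (τ.horizontalLift_add_vert p z).symm.trans
          (congrArg₂ (fun u w : EP => u + w) rfl (add_zero _).symm)
      have hvs : v = (η.horizontalLift γ
          (mfderiv 𝓘(ℝ, ES) 𝓘(ℝ, EM) Φ.orbitSpaceProj (Φ.toOrbitSpace p) a) : E𝒢) +
            (0 + (η.vert γ v : E𝒢)) :=
        (η.horizontalLift_add_vert γ v).symm.trans (congrArg₂ (fun u w : E𝒢 => u + w)
          (congrArg (η.horizontalLift γ) hb.symm) (zero_add _).symm)
      exact (congrArg₂ (fun (z : EP) (v : E𝒢) => (Φ.tangentAct p γ z v : EP)) hzs hvs).trans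
        ((Φ.tangentAct_add p γ _ _ _ _).trans (congrArg₂ (fun u w : EP => u + w) hH.symm
          ((Φ.tangentAct_add p γ _ _ _ _).trans
            (congrArg₂ (fun u w : EP => u + w) hR hL))))
    -- `TΦ(z', v')` is vertical over `𝒮` as soon as `z'` is; used for `(ω z, 0)` and `(0, ν v)`.
    have hvert : ∀ (z' : EP) (v' : E𝒢),
        (mfderiv 𝓘(ℝ, EP) 𝓘(ℝ, ES) Φ.toOrbitSpace p z' : ES) = 0 →
        (mfderiv 𝓘(ℝ, EP) 𝓘(ℝ, EM) πP p z' : EM) = mfderiv 𝓘(ℝ, E𝒢) 𝓘(ℝ, EM) π𝒢 γ v' →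
        τ.vert (Φ.act p γ) (Φ.tangentAct p γ z' v') = Φ.tangentAct p γ z' v' :=
      fun z' v' h0 h1 => τ.vert_eq_self _ _
        ((Φ.mfderiv_toOrbitSpace_tangentAct hP hS hx z' v' h1).trans h0)
    have hVR := hvert (τ.vert p z) (0 : E𝒢) (τ.mfderiv_vert p z)
      (hz0.trans (map_zero _).symm)
    have hVL := hvert (0 : EP) (η.vert γ v) (map_zero _) ((map_zero _).trans hv0.symm)
    rw [hR] at hVR
    rw [hL] at hVL
    exact (congrArg (τ.vert (Φ.act p γ)) hsplit).trans ((map_add (τ.vert (Φ.act p γ)) _ _).trans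
      ((congrArg₂ (· + ·) (τ.vert_horizontalLift (Φ.act p γ) a)
        ((map_add (τ.vert (Φ.act p γ)) _ _).trans (congrArg₂ (· + ·) hVR hVL))).trans
          (zero_add _)))
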